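/- Let $R=[r^1,\dots,r^k]\in\mathbb{Q}^{2\times k}$ have nonzero columns with $\operatorname{cone}\{r^1,\dots,r^k\}=\mathbb{R}^2$, let $f\in\mathbb{Q}^2\setminus\mathbb{Z}^2$, and let $$P(R,f)=\{(x,s)\in\mathbb{Z}^2\times\mathbb{R}^k_+ : x=f+Rs\},\qquad P(R,f)^0=\{(x,s)\in\mathbb{R}^2\times\mathbb{R}^k_+ : x=f+Rs\}.$$ For a set $Q\subseteq\mathbb{R}^2\times\mathbb{R}^k$, its split closure is the intersection, over all $\pi\in\mathbb{Z}^2$ and $\pi_0\in\mathbb{Z}$, of the sets $$\operatorname{conv}\bigl((Q\cap\{\pi^Tx\le\pi_0\})\cup(Q\cap\{\pi^Tx\ge\pi_0+1\})\bigr).$$ Starting from $Q^0=P(R,f)^0$, let $Q^{n+1}$ be the split closure of $Q^n$. The split rank of an inequality (with respect to $P(R,f)^0$) is the smallest $n\ge 0$ such that the inequality is valid for $Q^n$, and $+\infty$ if there is no such $n$. Let $\alpha\in\mathbb{R}^k_+$ be such that $\sum_{i=1}^k\alpha_is_i\ge 1$ is valid for $\operatorname{conv}(P(R,f))$, and let $$L_\alpha=\operatorname{conv}\Bigl(\{f\}\cup\bigl\{f+\tfrac{1}{\alpha_i}r^i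 : \alpha_i>0\bigr\}\Bigr)+\operatorname{cone}\{r^i:\alpha_i=0\}$$ be its induced lattice-free set. A triangle of type $T^{2B}$ is a (nondegenerate) triangle whose interior contains no point of $\mathbb{Z}^2$ and which has a vertex $v\notin\mathbb{Z}^2$ such that the side opposite to $v$ contains at least two integer points (possibly end points), one of the two sides incident to $v$ contains exactly one integer point in its relative interior, and the other side incident to $v$ contains no integer point in its relative interior. **Proposition.** If $L_\alpha$ is a triangle of type $T^{2B}$, then the split rank of $\sum_{i=1}^k\alpha_is_i\ge 1$ with respect to $P(R,f)^0$ is finite. -/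

import Mathlib

open scoped Matrix Pointwise

noncomputable section

/-! ### Valid inequalities, split closures and split rank

A point of `ℝ^p × ℝ^q` is a pair `z = (x, y)`; the integer variables are the coordinates of `x`. -/

/-- The inequality `aᵀ x + bᵀ y ≤ γ` is valid for the set `S ⊆ ℝ^p × ℝ^q`. -/
def IsValidIneq {p q : ℕ} (a : Fin p → ℝ) (b : Fin q → ℝ) (γ : ℝ)
    (S : Set ((Fin p → ℝ) × (Fin q → ℝ))) : Prop :=
  ∀ z ∈ S, a ⬝ᵥ z.1 + b ⬝ᵥ z.2 ≤ γ

/-- The convex hull of the two parts of `Q` that are cut out by the split disjunction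
`πᵀ x ≤ π₀` or `πᵀ x ≥ π₀ + 1`. -/
def splitHull {p q : ℕ} (Q : Set ((Fin p → ℝ) × (Fin q → ℝ))) (π : Fin p → ℤ) (π₀ : ℤ) :
    Set ((Fin p → ℝ) × (Fin q → ℝ)) :=
  convexHull ℝ
    ((Q ∩ {z | (fun i => (π i : ℝ)) ⬝ᵥ z.1 ≤ (π₀ : ℝ)}) ∪
     (Q ∩ {z | (π₀ : ℝ) + 1 ≤ (fun i => (π i : ℝ)) ⬝ᵥ z.1}))

/-- The first split closure of `Q`: the intersection over all split disjunctions. -/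
def splitClosure {p q : ℕ} (Q : Set ((Fin p → ℝ) × (Fin q → ℝ))) :
    Set ((Fin p → ℝ) × (Fin q → ℝ)) :=
  ⋂ (π : Fin p → ℤ) (π₀ : ℤ), splitHull Q π π₀

/-- The `n`-th split closure of `Q`; the `0`-th one is `Q` itself. -/
def iterSplitClosure {p q : ℕ} (Q : Set ((Fin p → ℝ) × (Fin q → ℝ))) :
    ℕ → Set ((Fin p → ℝ) × (Fin q → ℝ))
  | 0 => Q
  | n + 1 => splitClosure (iterSplitClosure Q n)

/-- The split rank of `aᵀ x + bᵀ y ≤ γ` with respect to `Q`: the least `n` such that the inequality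
is valid for the `n`-th split closure of `Q`, and `⊤` if there is no such `n`. -/
def splitRank {p q : ℕ} (Q : Set ((Fin p → ℝ) × (Fin q → ℝ)))
    (a : Fin p → ℝ) (b : Fin q → ℝ) (γ : ℝ) : ℕ∞ :=
  ⨅ (n : ℕ) (_ : IsValidIneq a b γ (iterSplitClosure Q n)), (n : ℕ∞)

/-! ### The two-row set -/

/-- The integer lattice `ℤ²` in the plane. -/
def latticePoints : Set (Fin 2 → ℝ) :=
  {x | ∃ z : Fin 2 → ℤ, ∀ i, x i = (z i : ℝ)}

/-- The base point `f`, as a real vector. -/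
def realPoint (f : Fin 2 → ℚ) : Fin 2 → ℝ := fun j => (f j : ℝ)

/-- The `i`-th column `r^i` of `R`, as a real vector. -/
def ray {k : ℕ} (R : Matrix (Fin 2) (Fin k) ℚ) (i : Fin k) : Fin 2 → ℝ := fun j => (R j i : ℝ)

/-- The linear relaxation `P(R,f)⁰`: all `(x, s)` with `x = f + R s` and `s ≥ 0`. -/
def linearRelaxation {k : ℕ} (R : Matrix (Fin 2) (Fin k) ℚ) (f : Fin 2 → ℚ) :
    Set ((Fin 2 → ℝ) × (Fin k → ℝ)) :=
  {z | z.1 = realPoint f + ∑ i, z.2 i • ray R i ∧ ∀ i, 0 ≤ z.2 i}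

/-- The mixed integer set `P(R,f)`: the points `(x, s)` of the linear relaxation with `x ∈ ℤ²`. -/
def mixedIntegerSet {k : ℕ} (R : Matrix (Fin 2) (Fin k) ℚ) (f : Fin 2 → ℚ) :
    Set ((Fin 2 → ℝ) × (Fin k → ℝ)) :=
  {z | z ∈ linearRelaxation R f ∧ z.1 ∈ latticePoints}

/-- The set `L_α` induced by the inequality `∑ α_i s_i ≥ 1`: the convex hull of `f` and of the
points `f + r^i / α_i` with `α_i > 0`, plus the cone generated by the `r^i` with `α_i = 0`. -/
def inducedSet {k : ℕ} (R : Matrix (Fin 2) (Fin k) ℚ) (f : Fin 2 → ℚ) (α : Fin k → ℝ) :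
    Set (Fin 2 → ℝ) :=
  convexHull ℝ
      ({x | ∃ i, 0 < α i ∧ x = realPoint f + (α i)⁻¹ • ray R i} ∪ {realPoint f}) +
    (PointedCone.hull ℝ {x | ∃ i, α i = 0 ∧ x = ray R i} : Set (Fin 2 → ℝ))

/-- A set in the plane is lattice-free if its interior contains no integer point. -/
def IsLatticeFree (S : Set (Fin 2 → ℝ)) : Prop :=
  interior S ∩ latticePoints = ∅

/-- Lattice-free triangles of type `T^{2B}`: the vertex `v` is not integral, the opposite side `uw`
contains at least two integer points (end points are allowed), the side `uv` contains exactly one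
integer point in its relative interior, and the side `vw` contains none in its relative interior. -/
def IsTypeT2B (L : Set (Fin 2 → ℝ)) : Prop :=
  ∃ u v w : Fin 2 → ℝ,
    AffineIndependent ℝ ![u, v, w] ∧
    L = convexHull ℝ {u, v, w} ∧
    IsLatticeFree L ∧
    v ∉ latticePoints ∧
    (segment ℝ u w ∩ latticePoints).Nontrivial ∧
    (∃! p, p ∈ openSegment ℝ u v ∩ latticePoints) ∧
    openSegment ℝ v w ∩ latticePoints = ∅

end

noncomputable section

/-! Let x₁, x₂ be integral coordinates in which the triangle has vertices u = (-a, 0), v = ((τ-1)a,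
τ), w = (d, 0), with (0, 1) on uv (`IsTypeT2B.exists_coordinates`). An affine form ℓ that is
nonconstant and nonnegative on `L_α` is positive at f and gives αᵀs ≥ 1 - ℓ(x)/ℓ(f) on the
relaxation. Four such bounds are used: one for each side, and one for the line through v and (1, 1).

Suppose αᵀs ≥ 1 - ε is known. A split parallel to uv tilts the bound of that side. The split on x₁
then yields αᵀs ≥ 1 - ε' - K(1 - x₂) with ε' = max 0 (ε - β), and the split on x₂ yields αᵀs ≥ 1 -
ε' (`splitClosure_lower_bound`). The gain β does not depend on ε, so finitely many triples of splits
reach 1 (`exists_iterSplitClosure_one_le`).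

The first split needs the direction of uv to be rational. Although α may be irrational,
`exists_rat_of_inducedSet` shows that a is rational, since u must be a generator of `L_α` on the
integral line x₂ = 0. -/

/-! ### Split closures and convex supersets -/

/-- The integral affine form `x ↦ πᵀ x - c`. -/
def intForm {p : ℕ} (π : Fin p → ℤ) (c : ℤ) (x : Fin p → ℝ) : ℝ :=
  (fun i => (π i : ℝ)) ⬝ᵥ x - c

lemma intForm_combo {p : ℕ} (π : Fin p → ℤ) (c : ℤ) (x y : Fin p → ℝ) {a b : ℝ} (hab : a + b = 1) :
    intForm π c (a • x + b • y) = a * intForm π c x + b * intForm π c y := by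
  simp only [intForm, dotProduct_add, dotProduct_smul, smul_eq_mul]
  linear_combination (c : ℝ) * hab

/-- If both parts of `Q` cut out by the disjunction `intForm π c ≤ 0` or `intForm π c ≥ 1` lie in
a convex set, then so does the split closure of `Q`. -/
lemma splitClosure_subset_of_convex {p q : ℕ} {Q H : Set ((Fin p → ℝ) × (Fin q → ℝ))}
    (hH : Convex ℝ H) (π : Fin p → ℤ) (c : ℤ)
    (h₀ : ∀ z ∈ Q, intForm π c z.1 ≤ 0 → z ∈ H) (h₁ : ∀ z ∈ Q, 1 ≤ intForm π c z.1 → z ∈ H) :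
    splitClosure Q ⊆ H := by
  intro z hz
  have hz' : z ∈ splitHull Q π c := Set.mem_iInter.1 (Set.mem_iInter.1 hz π) c
  refine convexHull_min ?_ hH hz'
  rintro y (⟨hy, hy'⟩ | ⟨hy, hy'⟩)
  · exact h₀ y hy (by simp only [intForm]; simp only [Set.mem_ofPred_eq] at hy'; linarith)
  · exact h₁ y hy (by simp only [intForm]; simp only [Set.mem_ofPred_eq] at hy'; linarith)

/-- The zero split already suffices. Consequently a linear inequality, once obtained, survives all
later closures. -/
lemma splitClosure_subset_of_subset {p q : ℕ} {Q H : Set ((Fin p → ℝ) × (Fin q → ℝ))}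
    (hH : Convex ℝ H) (h : Q ⊆ H) : splitClosure Q ⊆ H :=
  splitClosure_subset_of_convex hH 0 0 (fun _ hz _ => h hz) (fun _ hz _ => h hz)

lemma iterSplitClosure_subset_of_subset {p q : ℕ} {Q H : Set ((Fin p → ℝ) × (Fin q → ℝ))}
    (hH : Convex ℝ H) (h : Q ⊆ H) (n : ℕ) : iterSplitClosure Q n ⊆ H := by
  induction n with
  | zero => exact h
  | succ n ih => exact splitClosure_subset_of_subset hH ih

lemma convex_setOf_intForm_le {p q : ℕ} (α : Fin q → ℝ) (π₁ π₂ : Fin p → ℤ) (c₁ c₂ : ℤ)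
    (e₀ e₁ e₂ : ℝ) :
    Convex ℝ {z : (Fin p → ℝ) × (Fin q → ℝ) |
      e₀ + e₁ * intForm π₁ c₁ z.1 + e₂ * intForm π₂ c₂ z.1 ≤ α ⬝ᵥ z.2} := by
  intro x hx y hy a b ha hb hab
  simp only [Set.mem_ofPred_eq, Prod.fst_add, Prod.snd_add, Prod.smul_fst, Prod.smul_snd] at *
  rw [intForm_combo _ _ _ _ hab, intForm_combo _ _ _ _ hab, dotProduct_add, dotProduct_smul,
    dotProduct_smul, smul_eq_mul, smul_eq_mul]
  have h1 := mul_le_mul_of_nonneg_left hx ha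
  have h2 := mul_le_mul_of_nonneg_left hy hb
  have h3 : e₀ = a * e₀ + b * e₀ := by rw [← add_mul, hab, one_mul]
  linarith

/-! ### A fixed gain from three splits -/

/-- Three split closures lift the lower bound `1 - ε` on `αᵀ s` by the fixed amount `β`. -/
lemma splitClosure_lower_bound {p q : ℕ} {Q : Set ((Fin p → ℝ) × (Fin q → ℝ))} {α : Fin q → ℝ}
    {π₁ π₂ π₃ : Fin p → ℤ} {c₁ c₂ c₃ : ℤ} {ω c a n A B σ s r K β ε : ℝ}
    (ha : 0 < a) (hn : 0 < n) (hω : 0 < ω) (hA : 0 ≤ A) (hs : 0 ≤ s)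
    (hc : 0 < c) (hK : 0 < K) (hKc : K ≤ c * a) (hKB : K ≤ B) (hβ : 0 < β)
    (hβa : n * a * β ≤ K) (hβσ : |r| * β ≤ σ * K) (hε : 0 ≤ ε)
    (hπ₃ : ∀ x, intForm π₃ c₃ x = n * (intForm π₁ c₁ x + a * (1 - intForm π₂ c₂ x)))
    (h₁ : ∀ z ∈ Q, 1 - ω * intForm π₂ c₂ z.1 ≤ α ⬝ᵥ z.2)
    (h₂ : ∀ z ∈ Q, 1 - c * (intForm π₁ c₁ z.1 + a * (1 - intForm π₂ c₂ z.1)) ≤ α ⬝ᵥ z.2)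
    (h₃ : ∀ z ∈ Q, 1 + A * (intForm π₁ c₁ z.1 - 1) + B * (intForm π₂ c₂ z.1 - 1) ≤ α ⬝ᵥ z.2)
    (h₄ : ∀ z ∈ Q, 1 + σ + s * (intForm π₁ c₁ z.1 - 1) + r * (intForm π₂ c₂ z.1 - 1) ≤ α ⬝ᵥ z.2)
    (h₅ : ∀ z ∈ Q, 1 - ε ≤ α ⬝ᵥ z.2) :
    ∀ z ∈ splitClosure (splitClosure (splitClosure Q)), 1 - max 0 (ε - β) ≤ α ⬝ᵥ z.2 := by
  have conv : ∀ e₀ e₁ e₂ : ℝ, Convex ℝ {z : (Fin p → ℝ) × (Fin q → ℝ) |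
      e₀ + e₁ * intForm π₁ c₁ z.1 + e₂ * intForm π₂ c₂ z.1 ≤ α ⬝ᵥ z.2} :=
    convex_setOf_intForm_le α π₁ π₂ c₁ c₂
  have keep : ∀ (e₀ e₁ e₂ : ℝ) {Q : Set ((Fin p → ℝ) × (Fin q → ℝ))},
      (∀ z ∈ Q, e₀ + e₁ * intForm π₁ c₁ z.1 + e₂ * intForm π₂ c₂ z.1 ≤ α ⬝ᵥ z.2) →
      ∀ z ∈ splitClosure Q, e₀ + e₁ * intForm π₁ c₁ z.1 + e₂ * intForm π₂ c₂ z.1 ≤ α ⬝ᵥ z.2 :=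
    fun e₀ e₁ e₂ Q h => splitClosure_subset_of_subset (conv e₀ e₁ e₂) h
  set ε' := max 0 (ε - β) with hε'
  have hε'0 : 0 ≤ ε' := le_max_left _ _
  have hε'1 : ε - β ≤ ε' := le_max_right _ _
  -- Write g = x₁ + a(1 - x₂). For g ≤ 0 any slope at most c is implied by `h₂`; for n g ≥ 1 the
  -- slope ε n is implied by αᵀs ≥ 1 - ε. The minimum serves both sides of the split.
  set c' := min c (ε * n) with hc'
  have g₂ : ∀ z ∈ splitClosure Q,
      1 - c' * (intForm π₁ c₁ z.1 + a * (1 - intForm π₂ c₂ z.1)) ≤ α ⬝ᵥ z.2 := by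
    have : splitClosure Q ⊆ _ := splitClosure_subset_of_convex (conv (1 - c' * a) (-c') (c' * a))
      π₃ c₃ ?_ ?_
    · intro z hz
      have := this hz
      simp only [Set.mem_ofPred_eq] at this
      linarith
    · intro z hz hz'
      rw [hπ₃] at hz'
      have := h₂ z hz
      simp only [Set.mem_ofPred_eq]
      have hg := nonpos_of_mul_nonpos_right hz' hn
      have := mul_le_mul_of_nonpos_right (min_le_left c (ε * n)) hg
      linarith
    · intro z hz hz'
      rw [hπ₃] at hz'
      have h2 := h₂ z hz
      have h5 := h₅ z hz
      simp only [Set.mem_ofPred_eq]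
      rcases min_choice c (ε * n) with h | h
      · rw [hc', h]; linarith
      · rw [hc', h]
        have := mul_le_mul_of_nonneg_left hz' hε
        linarith
  have g₁ : ∀ z ∈ splitClosure (splitClosure Q), 1 - ω * intForm π₂ c₂ z.1 ≤ α ⬝ᵥ z.2 := by
    intro z hz
    have := keep 1 0 (-ω) (keep 1 0 (-ω) fun z hz => by linarith [h₁ z hz]) z hz
    linarith
  have k₂ : ∀ z ∈ splitClosure Q,
      1 - c * (intForm π₁ c₁ z.1 + a * (1 - intForm π₂ c₂ z.1)) ≤ α ⬝ᵥ z.2 := by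
    intro z hz
    have := keep (1 - c * a) (-c) (c * a) (fun z hz => by linarith [h₂ z hz]) z hz
    linarith
  have k₃ : ∀ z ∈ splitClosure Q,
      1 + A * (intForm π₁ c₁ z.1 - 1) + B * (intForm π₂ c₂ z.1 - 1) ≤ α ⬝ᵥ z.2 := by
    intro z hz
    have := keep (1 - A - B) A B (fun z hz => by linarith [h₃ z hz]) z hz
    linarith
  have k₄ : ∀ z ∈ splitClosure Q,
      1 + σ + s * (intForm π₁ c₁ z.1 - 1) + r * (intForm π₂ c₂ z.1 - 1) ≤ α ⬝ᵥ z.2 := by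
    intro z hz
    have := keep (1 + σ - s - r) s r (fun z hz => by linarith [h₄ z hz]) z hz
    linarith
  have k₅ : ∀ z ∈ splitClosure Q, 1 - ε ≤ α ⬝ᵥ z.2 := by
    intro z hz
    have := keep (1 - ε) 0 0 (fun z hz => by linarith [h₅ z hz]) z hz
    linarith
  have g₃ : ∀ z ∈ splitClosure (splitClosure Q),
      1 - ε' - K * (1 - intForm π₂ c₂ z.1) ≤ α ⬝ᵥ z.2 := by
    have : splitClosure (splitClosure Q) ⊆ _ :=
      splitClosure_subset_of_convex (conv (1 - ε' - K) 0 K) π₁ c₁ ?_ ?_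
    · intro z hz
      have := this hz
      simp only [Set.mem_ofPred_eq] at this
      linarith
    · intro z hz hz'
      simp only [Set.mem_ofPred_eq]
      have e2 := k₂ z hz
      have e2' := g₂ z hz
      have e5 := k₅ z hz
      generalize intForm π₁ c₁ z.1 = x at *
      generalize hy : intForm π₂ c₂ z.1 = x₂ at *
      obtain ⟨y, rfl⟩ : ∃ y, x₂ = 1 - y := ⟨1 - x₂, by ring⟩
      have hcx : c * x ≤ 0 := mul_nonpos_of_nonneg_of_nonpos hc.le hz'
      rcases le_total y 0 with hy0 | hy0
      · have := mul_le_mul_of_nonpos_right hKc hy0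
        linarith
      -- If K y ≥ β, then 1 - ε is already enough. Otherwise n a y ≤ 1, and the tilted bound loses
      -- at most ε n a y ≤ ε' + K y.
      · rcases le_total β (K * y) with hb | hb
        · linarith
        · have hc'0 : 0 ≤ c' := le_min hc.le (by positivity)
          have hcx' : c' * x ≤ 0 := mul_nonpos_of_nonneg_of_nonpos hc'0 hz'
          have hay : 0 ≤ a * y := by positivity
          have e3 : c' * (a * y) ≤ ε * n * (a * y) :=
            mul_le_mul_of_nonneg_right (min_le_right _ _) hay
          have e4 : ε * n * (a * y) ≤ ε' + K * y := by
            have e6 : n * a * y * β ≤ K * y := by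
              have := mul_le_mul_of_nonneg_right hβa hy0
              linarith
            have e7 : n * a * y ≤ 1 := by
              by_contra hcon
              push Not at hcon
              have := mul_lt_mul_of_pos_right hcon hβ
              linarith
            have e8 : (ε - β) * (n * a * y) ≤ ε' := by
              have e9 : (ε - β) * (n * a * y) ≤ ε' * (n * a * y) :=
                mul_le_mul_of_nonneg_right hε'1 (by positivity)
              have := mul_le_mul_of_nonneg_left e7 hε'0
              linarith
            linarith
          linarith
    · intro z hz hz'
      simp only [Set.mem_ofPred_eq]
      have e3 := k₃ z hz
      have e4 := k₄ z hz
      have e5 := k₅ z hz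
      generalize intForm π₁ c₁ z.1 = x at *
      generalize hy : intForm π₂ c₂ z.1 = x₂ at *
      obtain ⟨y, rfl⟩ : ∃ y, x₂ = 1 - y := ⟨1 - x₂, by ring⟩
      have hAx : 0 ≤ A * (x - 1) := mul_nonneg hA (by linarith)
      have hsx : 0 ≤ s * (x - 1) := mul_nonneg hs (by linarith)
      rcases le_total y 0 with hy0 | hy0
      · have := mul_le_mul_of_nonpos_right hKB hy0
        linarith
      · rcases le_total β (K * y) with hb | hb
        · linarith
        -- Just below (1, 1) the surplus σ of the side vw at that point absorbs the term r y.
        · have e6 : r * y ≤ σ := by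
            have e7 : r * y ≤ |r| * y := mul_le_mul_of_nonneg_right (le_abs_self r) hy0
            have e8 : |r| * (K * y) ≤ |r| * β := mul_le_mul_of_nonneg_left hb (abs_nonneg r)
            have e9 : (|r| * y) * K ≤ σ * K := by linarith
            linarith [le_of_mul_le_mul_right e9 hK]
          have : 0 ≤ K * y := by positivity
          linarith
  have : splitClosure (splitClosure (splitClosure Q)) ⊆ _ :=
      splitClosure_subset_of_convex (conv (1 - ε') 0 0) π₂ c₂ ?_ ?_
  · intro z hz
    have := this hz
    simp only [Set.mem_ofPred_eq] at this
    linarith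
  · intro z hz hz'
    have := g₁ z hz
    have := mul_nonpos_of_nonneg_of_nonpos hω.le hz'
    simp only [Set.mem_ofPred_eq]
    linarith
  · intro z hz hz'
    have := g₃ z hz
    have : 0 ≤ K * (intForm π₂ c₂ z.1 - 1) := mul_nonneg hK.le (by linarith)
    simp only [Set.mem_ofPred_eq]
    linarith

/-- The four planes persist through all closures and the gain β is built from their constants alone.
Hence the deficit, at most 1 at the start by `h₀`, drops by β in every triple of closures until it
vanishes. -/
theorem exists_iterSplitClosure_one_le {p q : ℕ} {Q : Set ((Fin p → ℝ) × (Fin q → ℝ))}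
    {α : Fin q → ℝ} {π₁ π₂ π₃ : Fin p → ℤ} {c₁ c₂ c₃ : ℤ} {ω c a n A B σ s r : ℝ}
    (ha : 0 < a) (hn : 0 < n) (hω : 0 < ω) (hA : 0 ≤ A) (hs : 0 ≤ s)
    (hc : 0 < c) (hB : 0 < B) (hσ : 0 < σ)
    (hπ₃ : ∀ x, intForm π₃ c₃ x = n * (intForm π₁ c₁ x + a * (1 - intForm π₂ c₂ x)))
    (h₀ : ∀ z ∈ Q, 0 ≤ α ⬝ᵥ z.2)
    (h₁ : ∀ z ∈ Q, 1 - ω * intForm π₂ c₂ z.1 ≤ α ⬝ᵥ z.2)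
    (h₂ : ∀ z ∈ Q, 1 - c * (intForm π₁ c₁ z.1 + a * (1 - intForm π₂ c₂ z.1)) ≤ α ⬝ᵥ z.2)
    (h₃ : ∀ z ∈ Q, 1 + A * (intForm π₁ c₁ z.1 - 1) + B * (intForm π₂ c₂ z.1 - 1) ≤ α ⬝ᵥ z.2)
    (h₄ : ∀ z ∈ Q,
      1 + σ + s * (intForm π₁ c₁ z.1 - 1) + r * (intForm π₂ c₂ z.1 - 1) ≤ α ⬝ᵥ z.2) :
    ∃ N, ∀ z ∈ iterSplitClosure Q N, 1 ≤ α ⬝ᵥ z.2 := by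
  have keep : ∀ (e₀ e₁ e₂ : ℝ),
      (∀ z ∈ Q, e₀ + e₁ * intForm π₁ c₁ z.1 + e₂ * intForm π₂ c₂ z.1 ≤ α ⬝ᵥ z.2) →
      ∀ m, ∀ z ∈ iterSplitClosure Q m,
        e₀ + e₁ * intForm π₁ c₁ z.1 + e₂ * intForm π₂ c₂ z.1 ≤ α ⬝ᵥ z.2 :=
    fun e₀ e₁ e₂ h m =>
      iterSplitClosure_subset_of_subset (convex_setOf_intForm_le α π₁ π₂ c₁ c₂ e₀ e₁ e₂) h m
  set K := min (c * a) B with hK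
  have hK0 : 0 < K := lt_min (by positivity) hB
  set β := min (K / (n * a)) (σ * K / (|r| + 1)) with hβ
  have hr : 0 < |r| + 1 := by positivity
  have hβ0 : 0 < β := lt_min (by positivity) (by positivity)
  have hβa : n * a * β ≤ K := by
    have := min_le_left (K / (n * a)) (σ * K / (|r| + 1))
    rw [← hβ, le_div_iff₀ (by positivity)] at this
    linarith
  have hβσ : |r| * β ≤ σ * K := by
    have := min_le_right (K / (n * a)) (σ * K / (|r| + 1))
    rw [← hβ, le_div_iff₀ (by positivity)] at this
    linarith
  have main : ∀ m : ℕ, ∀ z ∈ iterSplitClosure Q (3 * m), 1 - max 0 (1 - m * β) ≤ α ⬝ᵥ z.2 := by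
    intro m
    induction m with
    | zero =>
      intro z hz
      simpa using h₀ z hz
    | succ m ih =>
      intro z hz
      have := splitClosure_lower_bound (Q := iterSplitClosure Q (3 * m)) (ε := max 0 (1 - m * β))
        ha hn hω hA hs hc hK0 (min_le_left _ _) (min_le_right _ _) hβ0 hβa hβσ (le_max_left _ _)
        hπ₃
        (fun z hz => by linarith [keep 1 0 (-ω) (fun z hz => by linarith [h₁ z hz]) _ z hz])
        (fun z hz => by
          linarith [keep (1 - c * a) (-c) (c * a) (fun z hz => by linarith [h₂ z hz]) _ z hz])
        (fun z hz => by
          linarith [keep (1 - A - B) A B (fun z hz => by linarith [h₃ z hz]) _ z hz])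
        (fun z hz => by
          linarith [keep (1 + σ - s - r) s r (fun z hz => by linarith [h₄ z hz]) _ z hz])
        ih z hz
      refine le_trans ?_ this
      push_cast
      have h1 : max 0 (max 0 (1 - m * β) - β) ≤ max 0 (1 - (m + 1) * β) := by
        refine max_le (le_max_left _ _) ?_
        rcases max_choice 0 (1 - m * β) with h | h <;> rw [h]
        · exact le_trans (by linarith) (le_max_left _ _)
        · exact le_trans (by linarith) (le_max_right _ _)
      linarith
  obtain ⟨m, hm⟩ := exists_nat_gt (1 / β)
  refine ⟨3 * m, fun z hz => ?_⟩
  have := main m z hz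
  rw [div_lt_iff₀ hβ0] at hm
  rwa [max_eq_left (by linarith), sub_zero] at this

/-! ### Normal form of the triangle -/

/-- An integer point of a lattice-free triangle that lies off the side `uw` lies in the relative
interior of the side `uv`, if `v` is not integral and the interior of `vw` has no integer point. -/
lemma mem_openSegment_of_mem_triangle {u v w p : Fin 2 → ℝ} (hind : AffineIndependent ℝ ![u, v, w])
    (hfree : IsLatticeFree (convexHull ℝ {u, v, w})) (hv : v ∉ latticePoints)
    (hvw : openSegment ℝ v w ∩ latticePoints = ∅)
    (hp : p ∈ convexHull ℝ {u, v, w}) (hpZ : p ∈ latticePoints) (hpuw : p ∉ segment ℝ u w) :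
    p ∈ openSegment ℝ u v := by
  have htop : affineSpan ℝ (Set.range ![u, v, w]) = ⊤ := by
    rw [hind.affineSpan_eq_top_iff_card_eq_finrank_add_one]
    simp
  let b : AffineBasis (Fin 3) ℝ (Fin 2 → ℝ) := ⟨![u, v, w], hind, htop⟩
  have hrange : Set.range b = {u, v, w} := by
    change Set.range ![u, v, w] = _
    ext x
    simp only [Matrix.range_cons, Matrix.range_empty, Set.union_empty, Set.singleton_union]
  rw [← hrange] at hp hfree
  have hsum := b.sum_coord_apply_eq_one p
  have hcomb := b.linear_combination_coord_eq_self p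
  have hnn : ∀ i, 0 ≤ b.coord i p := by
    rw [b.convexHull_eq_nonneg_coord] at hp
    exact hp
  have hint : ¬ ∀ i, 0 < b.coord i p := by
    intro h
    have : p ∈ interior (convexHull ℝ (Set.range b)) ∩ latticePoints := by
      refine ⟨?_, hpZ⟩
      rw [b.interior_convexHull]
      exact h
    rw [hfree] at this
    exact this
  rw [Fin.sum_univ_three] at hsum hcomb
  change b.coord 0 p • u + b.coord 1 p • v + b.coord 2 p • w = p at hcomb
  have n0 := hnn 0
  have n1 := hnn 1
  have n2 := hnn 2
  rw [Fin.forall_fin_succ, Fin.forall_fin_succ, Fin.forall_fin_succ] at hint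
  change ¬ (0 < b.coord 0 p ∧ 0 < b.coord 1 p ∧ 0 < b.coord 2 p ∧ _) at hint
  generalize b.coord 0 p = c0 at *
  generalize b.coord 1 p = c1 at *
  generalize b.coord 2 p = c2 at *
  have hc1 : 0 < c1 := by
    refine lt_of_le_of_ne n1 fun h => hpuw ⟨c0, c2, n0, n2, by linarith, ?_⟩
    rw [← hcomb, ← h]; simp
  rcases n2.eq_or_lt with h2 | h2
  · rcases n0.eq_or_lt with h0 | h0
    · refine absurd hpZ ?_
      have : c1 = 1 := by linarith
      rw [← hcomb, ← h2, ← h0, this]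
      simpa using hv
    · refine ⟨c0, c1, h0, hc1, by linarith, ?_⟩
      rw [← hcomb, ← h2]; simp
  · rcases n0.eq_or_lt with h0 | h0
    · have : p ∈ openSegment ℝ v w ∩ latticePoints :=
        ⟨⟨c1, c2, hc1, h2, by linarith, by rw [← hcomb, ← h0]; simp⟩, hpZ⟩
      rw [hvw] at this
      exact absurd this (Set.notMem_empty _)
    · exact absurd ⟨h0, hc1, h2, fun i => i.elim0⟩ hint

lemma intForm_lineMap {p : ℕ} (π : Fin p → ℤ) (c : ℤ) (x y : Fin p → ℝ) (t : ℝ) :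
    intForm π c (x + t • (y - x)) = intForm π c x + t * (intForm π c y - intForm π c x) := by
  simp only [intForm, dotProduct_add, dotProduct_smul, dotProduct_sub, smul_eq_mul]
  ring

lemma intForm_intCast {p : ℕ} (π : Fin p → ℤ) (c : ℤ) (z : Fin p → ℤ) :
    intForm π c (fun i => (z i : ℝ)) = ((π ⬝ᵥ z - c : ℤ) : ℝ) := by
  simp [intForm, dotProduct]

lemma intForm_fin_two (π : Fin 2 → ℤ) (c : ℤ) (x : Fin 2 → ℝ) :
    intForm π c x = π 0 * x 0 + π 1 * x 1 - c := by
  simp [intForm, dotProduct, Fin.sum_univ_two]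

/-- Two distinct integer points on a line give integral coordinates `ρ`, `η` in which the line is
horizontal. -/
lemma exists_unimodular_of_ne (D : Fin 2 → ℤ) (hD : D ≠ 0) :
    ∃ (g : ℤ) (D' E ρ η : Fin 2 → ℤ), 0 < g ∧ (∀ i, D i = g * D' i) ∧
      intForm ρ 0 (fun i => (D' i : ℝ)) = 1 ∧ intForm η 0 (fun i => (D' i : ℝ)) = 0 ∧
      ∀ x : Fin 2 → ℝ, x = intForm ρ 0 x • (fun i => (D' i : ℝ)) +
        intForm η 0 x • (fun i => (E i : ℝ)) := by
  have hg : 0 < Int.gcd (D 0) (D 1) := by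
    rw [Nat.pos_iff_ne_zero, Ne, Int.gcd_eq_zero_iff]
    rintro ⟨h0, h1⟩
    exact hD (by ext i; fin_cases i <;> simp [h0, h1])
  obtain ⟨m, n, hmn, hm, hn⟩ := Int.exists_gcd_one hg
  obtain ⟨s, t, hst⟩ := Int.isCoprime_iff_gcd_eq_one.2 hmn
  have hst' : (s : ℝ) * m + t * n = 1 := by exact_mod_cast hst
  -- By Bézout, s m + t n = 1, so the columns (m, n) and (-t, s) form a unimodular matrix; ρ and η
  -- are the rows of its inverse.
  refine ⟨Int.gcd (D 0) (D 1), ![m, n], ![-t, s], ![s, t], ![-n, m], by exact_mod_cast hg,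
    ?_, ?_, ?_, ?_⟩
  · intro i
    fin_cases i
    · simpa [mul_comm] using hm
    · simpa [mul_comm] using hn
  · simpa [intForm_fin_two] using hst'
  · simp [intForm_fin_two]; ring
  · intro x
    ext i
    fin_cases i
    · simp [intForm_fin_two]
      linear_combination (-(x 0)) * hst'
    · simp [intForm_fin_two]
      linear_combination (-(x 1)) * hst'

/-- Changing the signs of η and E together preserves the decomposition, so η can be made positive on
any y not parallel to D. -/
lemma exists_unimodular_pos (D : Fin 2 → ℤ) (hD : D ≠ 0) (y : Fin 2 → ℝ)
    (hy : ∀ r : ℝ, y ≠ r • fun i => (D i : ℝ)) :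
    ∃ (g : ℤ) (D' E ρ η : Fin 2 → ℤ), 0 < g ∧ (∀ i, D i = g * D' i) ∧
      intForm ρ 0 (fun i => (D' i : ℝ)) = 1 ∧ intForm η 0 (fun i => (D' i : ℝ)) = 0 ∧
      (∀ x : Fin 2 → ℝ, x = intForm ρ 0 x • (fun i => (D' i : ℝ)) +
        intForm η 0 x • (fun i => (E i : ℝ))) ∧ 0 < intForm η 0 y := by
  obtain ⟨g, D', E, ρ, η, hg, hD', hρ, hη, hx⟩ := exists_unimodular_of_ne D hD
  have hne : intForm η 0 y ≠ 0 := by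
    intro h
    have := hx y
    rw [h, zero_smul, add_zero] at this
    refine hy (intForm ρ 0 y / g) ?_
    have hgR : (g : ℝ) ≠ 0 := by exact_mod_cast hg.ne'
    conv_lhs => rw [this]
    ext i
    simp only [Pi.smul_apply, smul_eq_mul, hD', Int.cast_mul]
    field_simp
  have hneg : ∀ x, intForm (-η) 0 x = -intForm η 0 x := by
    intro x
    simp [intForm_fin_two]; ring
  rcases lt_or_gt_of_ne hne with h | h
  · refine ⟨g, D', -E, ρ, -η, hg, hD', hρ, by rw [hneg, hη, neg_zero], ?_, by
      rw [hneg]; linarith⟩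
    intro x
    rw [hneg]
    refine (hx x).trans ?_
    ext i
    simp
  · exact ⟨g, D', E, ρ, η, hg, hD', hρ, hη, hx, h⟩

lemma exists_ordered_latticePoints {u w : Fin 2 → ℝ}
    (h : (segment ℝ u w ∩ latticePoints).Nontrivial) :
    ∃ (P P' : Fin 2 → ℤ) (μ μ' : ℝ), 0 ≤ μ ∧ μ < μ' ∧ μ' ≤ 1 ∧
      (fun i => (P i : ℝ)) = u + μ • (w - u) ∧ (fun i => (P' i : ℝ)) = u + μ' • (w - u) := by
  obtain ⟨x, ⟨hx, z, hz⟩, y, ⟨hy, z', hz'⟩, hxy⟩ := h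
  rw [segment_eq_image'] at hx hy
  obtain ⟨s, hs, rfl⟩ := hx
  obtain ⟨t, ht, rfl⟩ := hy
  rcases lt_trichotomy s t with hst | hst | hst
  · exact ⟨z, z', s, t, hs.1, hst, ht.2, funext fun i => (hz i).symm, funext fun i => (hz' i).symm⟩
  · exact absurd (by rw [hst]) hxy
  · exact ⟨z', z, t, s, ht.1, hst, hs.2, funext fun i => (hz' i).symm, funext fun i => (hz i).symm⟩

/-- In suitable integral coordinates, a triangle of type `T^{2B}` has the vertices `(-a, 0)`,
`((τ - 1) a, τ)` and `(d, 0)`, and the integer points `(0, 0)` and `(0, 1)` on two of its sides. -/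
lemma IsTypeT2B.exists_coordinates {L : Set (Fin 2 → ℝ)} (hL : IsTypeT2B L) :
    ∃ (u v w : Fin 2 → ℝ) (π₁ π₂ : Fin 2 → ℤ) (c₁ c₂ : ℤ) (a d τ : ℝ),
      L = convexHull ℝ {u, v, w} ∧
      intForm π₁ c₁ u = -a ∧ intForm π₂ c₂ u = 0 ∧
      intForm π₁ c₁ v = (τ - 1) * a ∧ intForm π₂ c₂ v = τ ∧
      intForm π₁ c₁ w = d ∧ intForm π₂ c₂ w = 0 ∧
      0 < a ∧ -a < d ∧ 1 < τ ∧ (τ - 1) * (d + a) < τ ∧ (τ - 1) * a < 1 := by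
  obtain ⟨u, v, w, hind, rfl, hfree, hv, hint, ⟨q, ⟨hq, zq, hzq⟩, hquniq⟩, hvw⟩ := hL
  -- All later contradictions come from this: a second integer point of the triangle off uw is
  -- impossible.
  have key : ∀ p ∈ convexHull ℝ {u, v, w}, p ∈ latticePoints → p ∉ segment ℝ u w → p = q :=
    fun p hp hpZ hps =>
      hquniq p ⟨mem_openSegment_of_mem_triangle hind hfree hv hvw hp hpZ hps, hpZ⟩
  obtain ⟨P, P', μ, μ', hμ, hμμ', hμ', hP, hP'⟩ := exists_ordered_latticePoints hint
  have hDR : (fun i => ((P' - P) i : ℝ)) = (μ' - μ) • (w - u) := by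
    have : (fun i => (((P' - P) i : ℤ) : ℝ)) = (fun i => (P' i : ℝ)) - fun i => (P i : ℝ) := by
      ext i; simp
    rw [this, hP, hP', sub_smul]
    abel
  have hnc : ∀ r : ℝ, v - u ≠ r • (w - u) := by
    intro r hr
    rw [affineIndependent_iff_not_collinear_set] at hind
    apply hind
    rw [collinear_iff_of_mem (p₀ := u) (by simp)]
    refine ⟨w - u, ?_⟩
    rintro p (rfl | rfl | rfl)
    · exact ⟨0, by simp⟩
    · exact ⟨r, by rw [← hr]; simp⟩
    · exact ⟨1, by simp⟩
  have hwu : w ≠ u := by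
    rintro rfl
    have := hind.injective.ne (show (0 : Fin 3) ≠ 2 by decide)
    exact this rfl
  have hD : P' - P ≠ 0 := by
    intro h
    have h0 : (μ' - μ) • (w - u) = 0 := by
      rw [← hDR, h]; ext i; simp
    rcases smul_eq_zero.1 h0 with h0 | h0
    · linarith
    · exact hwu (sub_eq_zero.1 h0)
  obtain ⟨g, D, E, ρ, η, hg, hgD, hρD, hηD, hrec, hηv⟩ :=
    exists_unimodular_pos (P' - P) hD (v - u) (by
      intro r
      rw [hDR, smul_smul]
      exact hnc _)
  have hgR : (1 : ℝ) ≤ g := by exact_mod_cast hg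
  have hadd : ∀ (π : Fin 2 → ℤ) (x y : Fin 2 → ℝ),
      intForm π 0 (x + y) = intForm π 0 x + intForm π 0 y := by
    intro π x y; simp [intForm_fin_two]; ring
  have hsub : ∀ (π : Fin 2 → ℤ) (x y : Fin 2 → ℝ),
      intForm π 0 (x - y) = intForm π 0 x - intForm π 0 y := by
    intro π x y; simp [intForm_fin_two]; ring
  have hsmul : ∀ (π : Fin 2 → ℤ) (t : ℝ) (x : Fin 2 → ℝ),
      intForm π 0 (t • x) = t * intForm π 0 x := by
    intro π t x; simp [intForm_fin_two]; ring
  set DR : Fin 2 → ℝ := fun i => (D i : ℝ) with hDRdef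
  set ER : Fin 2 → ℝ := fun i => (E i : ℝ) with hERdef
  set PR : Fin 2 → ℝ := fun i => (P i : ℝ) with hPRdef
  have hgDR : (g : ℝ) • DR = (μ' - μ) • (w - u) := by
    rw [← hDR]
    ext i
    have := hgD i
    simp only [Pi.smul_apply, smul_eq_mul, hDRdef]
    rw [this]; push_cast; ring
  have hwuD : w - u = (g / (μ' - μ)) • DR := by
    have : μ' - μ ≠ 0 := by linarith
    rw [div_eq_inv_mul, mul_smul, hgDR, smul_smul, inv_mul_cancel₀ this, one_smul]
  set l : ℝ := g / (μ' - μ) with hl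
  have hl0 : 0 < l := div_pos (by linarith) (by linarith)
  have hlg : (μ' - μ) * l = g := by
    rw [hl]; field_simp [show μ' - μ ≠ 0 by linarith]
  have hqZ : q = fun i => (zq i : ℝ) := funext hzq
  set τ := intForm η 0 (v - u) with hτ
  rw [openSegment_eq_image'] at hq
  obtain ⟨κ, ⟨hκ0, hκ1⟩, hqκ⟩ := hq
  simp only at hqκ
  have hηuw : ∀ p ∈ segment ℝ u w, intForm η 0 (p - u) = 0 := by
    intro p hp
    rw [segment_eq_image'] at hp
    obtain ⟨t, -, rfl⟩ := hp
    rw [add_sub_cancel_left, hsmul, hwuD, hsmul, hηD]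
    simp
  have huL : u ∈ convexHull ℝ {u, v, w} := subset_convexHull _ _ (by simp)
  have hvL : v ∈ convexHull ℝ {u, v, w} := subset_convexHull _ _ (by simp)
  have hwL : w ∈ convexHull ℝ {u, v, w} := subset_convexHull _ _ (by simp)
  have hconv : Convex ℝ (convexHull ℝ {u, v, w}) := convex_convexHull ℝ _
  have huvL : ∀ t : ℝ, 0 ≤ t → t ≤ 1 → u + t • (v - u) ∈ convexHull ℝ {u, v, w} := by
    intro t h0 h1
    exact hconv.add_smul_sub_mem huL hvL ⟨h0, h1⟩
  have huwL : ∀ t : ℝ, 0 ≤ t → t ≤ 1 → u + t • (w - u) ∈ convexHull ℝ {u, v, w} := by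
    intro t h0 h1
    exact hconv.add_smul_sub_mem huL hwL ⟨h0, h1⟩
  have hqL : q ∈ convexHull ℝ {u, v, w} := by
    rw [← hqκ]; exact huvL κ hκ0.le hκ1.le
  have key' : ∀ p ∈ convexHull ℝ {u, v, w}, p ∈ latticePoints → 0 < intForm η 0 (p - u) →
      p = q := fun p hp hpZ h => key p hp hpZ fun hs => by rw [hηuw p hs] at h; exact h.false
  have hPu : PR = u + (μ * l) • DR := by
    rw [hP, hwuD, smul_smul]
  have hηP : intForm η 0 (PR - u) = 0 := by
    rw [hPu, add_sub_cancel_left, hsmul, hηD, mul_zero]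
  have hηqP : intForm η 0 (q - PR) = κ * τ := by
    rw [← hqκ, hPu, show u + κ • (v - u) - (u + (μ * l) • DR) = κ • (v - u) - (μ * l) • DR by abel,
      hsub, hsmul, hsmul, hηD]
    ring
  have hqPcast : q - PR = fun i => ((zq - P) i : ℝ) := by
    rw [hqZ]; ext i; simp [hPRdef]
  obtain ⟨h, hh⟩ : ∃ h : ℤ, intForm η 0 (q - PR) = h := ⟨_, by rw [hqPcast, intForm_intCast]⟩
  obtain ⟨m, hm⟩ : ∃ m : ℤ, intForm ρ 0 (q - PR) = m := ⟨_, by rw [hqPcast, intForm_intCast]⟩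
  have hqrec : q - PR = (m : ℝ) • DR + (h : ℝ) • ER := by
    have := hrec (q - PR)
    rwa [hh, hm] at this
  have hhpos : 0 < h := by
    have : (0 : ℝ) < h := by rw [← hh, hηqP]; positivity
    exact_mod_cast this
  have hηE : intForm η 0 ER = 1 := by
    have := hh
    rw [hqrec, hadd, hsmul, hsmul, hηD] at this
    have hne : (h : ℝ) ≠ 0 := by exact_mod_cast hhpos.ne'
    have h2 : (h : ℝ) * intForm η 0 ER = h * 1 := by linarith
    exact mul_left_cancel₀ hne h2
  have hPDL : PR + DR ∈ convexHull ℝ {u, v, w} := by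
    have : PR + DR = u + (μ + 1 / l) • (w - u) := by
      rw [hwuD, hPu, smul_smul, add_mul, one_div, inv_mul_cancel₀ hl0.ne', add_smul, one_smul,
        add_assoc]
    rw [this]
    have h1 : 1 / l ≤ μ' - μ := by
      rw [div_le_iff₀ hl0, hlg]; exact hgR
    exact huwL _ (by positivity) (by linarith)
  have hPL : PR ∈ convexHull ℝ {u, v, w} := by
    rw [hP]; exact huwL _ hμ (by linarith)
  -- If q had height h ≥ 2 above uw, the triangle with vertices P, P + D, q would contain an integer
  -- point at height 1; rounding m / h up locates it.
  have hh1 : h = 1 := by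
    by_contra hne
    have h2 : 2 ≤ h := by omega
    have hhR : (0 : ℝ) < h := by exact_mod_cast hhpos
    set k := ⌈(m : ℝ) / h⌉ with hk
    have hk0 : (m : ℝ) / h ≤ k := Int.le_ceil _
    have hk1 : (k : ℝ) * h - m ≤ h - 1 := by
      have h3 : (k : ℝ) < m / h + 1 := Int.ceil_lt_add_one _
      have h4 : (k : ℝ) * h < m + h := by
        have := mul_lt_mul_of_pos_right h3 hhR
        rwa [add_mul, div_mul_cancel₀ _ hhR.ne', one_mul] at this
      have h5 : k * h < m + h := by exact_mod_cast h4
      have h6 : k * h - m ≤ h - 1 := by omega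
      exact_mod_cast h6
    have hp : PR + ((k : ℝ) • DR + ER) = q := by
      refine key' _ ?_ ⟨P + k • D + E, fun i => ?_⟩ ?_
      · have hθ0 : 0 ≤ (k : ℝ) - m / h := by linarith
        have hθ1 : 0 ≤ 1 - 1 / (h : ℝ) - (k - m / h) := by
          have : 1 - 1 / (h : ℝ) - (k - m / h) = (h - 1 - (k * h - m)) / h := by
            field_simp
          rw [this]
          exact div_nonneg (by linarith) hhR.le
        have : PR + ((k : ℝ) • DR + ER) = (1 / (h : ℝ)) • q + (1 - 1 / (h : ℝ) - (k - m / h)) • PR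
            + ((k : ℝ) - m / h) • (PR + DR) := by
          have hq' : q = PR + ((m : ℝ) • DR + (h : ℝ) • ER) := by rw [← hqrec]; abel
          rw [hq']
          ext i
          simp only [Pi.add_apply, Pi.smul_apply, smul_eq_mul]
          field_simp
          ring
        rw [this]
        have := hconv.sum_mem (t := Finset.univ)
          (w := ![1 / (h : ℝ), 1 - 1 / (h : ℝ) - (k - m / h), k - m / h])
          (z := ![q, PR, PR + DR]) (by
            intro i _
            fin_cases i
            · simpa using hhR.le
            · simpa using hθ1
            · simpa using hθ0)
          (by simp [Fin.sum_univ_three]; ring)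
          (by
            intro i _
            fin_cases i
            · exact hqL
            · exact hPL
            · exact hPDL)
        simpa [Fin.sum_univ_three] using this
      · simp [hPRdef, hDRdef, hERdef]; ring
      · rw [show PR + ((k : ℝ) • DR + ER) - u = (PR - u) + ((k : ℝ) • DR + ER) by abel, hadd, hadd,
          hsmul, hηP, hηD, hηE]
        norm_num
    have : intForm η 0 (q - PR) = 1 := by
      rw [← hp, add_sub_cancel_left, hadd, hsmul, hηD, hηE]
      ring
    rw [hh] at this
    exact hne (by exact_mod_cast this)
  rw [hh1, Int.cast_one] at hh
  have hκτ : κ * τ = 1 := by rw [← hηqP, hh]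
  have hτ1 : 1 < τ := by nlinarith
  have hκinv : κ = 1 / τ := by field_simp; exact hκτ
  set U : ℝ := -(μ * l) with hU
  -- The new origin is P + j D, the first integer point strictly beyond u on the line uw, so 0 < a ≤
  -- 1, with a = 1 when u is integral.
  set j : ℤ := ⌊U⌋ + 1 with hj
  have hj0 : U < j := by rw [hj]; push_cast; exact Int.lt_floor_add_one U
  have hj1 : (j : ℝ) ≤ U + 1 := by rw [hj]; push_cast; linarith [Int.floor_le U]
  set a : ℝ := j - U with ha
  have ha0 : 0 < a := by linarith
  set d : ℝ := l - a with hd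
  have hda : d + a = l := by rw [hd]; ring
  -- Otherwise the triangle has width at least 1 at height 1 and also contains q + D.
  have hE : (τ - 1) * (d + a) < τ := by
    by_contra hcon
    push Not at hcon
    rw [hda] at hcon
    have hp : q + DR = q := by
      refine key' _ ?_ ⟨zq + D, fun i => ?_⟩ ?_
      · have : q + DR = (1 - 1 / τ - 1 / l) • u + (1 / τ) • v + (1 / l) • w := by
          have hD' : DR = (1 / l) • (w - u) := by
            rw [hwuD, smul_smul, one_div, inv_mul_cancel₀ hl0.ne', one_smul]
          rw [hD', ← hqκ, hκinv]
          ext i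
          simp only [Pi.add_apply, Pi.smul_apply, Pi.sub_apply, smul_eq_mul]
          ring
        rw [this]
        have h0 : 0 ≤ 1 - 1 / τ - 1 / l := by
          have : 1 - 1 / τ - 1 / l = ((τ - 1) * l - τ) / (τ * l) := by
            field_simp
          rw [this]
          exact div_nonneg (by linarith) (by positivity)
        have := hconv.sum_mem (t := Finset.univ)
          (w := ![1 - 1 / τ - 1 / l, 1 / τ, 1 / l])
          (z := ![u, v, w]) (by
            intro i _
            fin_cases i
            · simpa using h0
            · simpa using (by linarith : 0 ≤ τ)
            · simpa using hl0.le)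
          (by simp [Fin.sum_univ_three]; ring)
          (by
            intro i _
            fin_cases i
            · exact huL
            · exact hvL
            · exact hwL)
        simpa [Fin.sum_univ_three] using this
      · simp [hqZ, hDRdef]
      · rw [show q + DR - u = (q - PR) + (PR - u) + DR by abel, hadd, hadd, hh, hηP, hηD]
        norm_num
    rw [add_eq_left] at hp
    rw [hp] at hρD
    simp [intForm_fin_two] at hρD
  -- If a = 1, then u is integral and a failure would put 2q - u on uv. If a < 1, the side uw has
  -- length at least 1 + a, and `hE` gives the claim.
  have hF : (τ - 1) * a < 1 := by
    by_cases ha1 : a = 1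
    · rw [ha1, mul_one]
      by_contra hcon
      push Not at hcon
      have hUj : U = j - 1 := by linarith
      have hu : u = fun i => ((P + (j - 1) • D) i : ℝ) := by
        have : u = PR + U • DR := by rw [hPu, hU, neg_smul]; abel
        rw [this, hUj]
        ext i
        simp [hPRdef, hDRdef]
      have hp : u + (2 * κ) • (v - u) = q := by
        refine key' _ (huvL _ (by positivity) ?_) ⟨2 • zq - (P + (j - 1) • D), fun i => ?_⟩ ?_
        · have : 2 * κ ≤ κ * τ := by nlinarith
          linarith
        · have : u + (2 * κ) • (v - u) = (2 : ℝ) • q - u := by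
            rw [← hqκ]
            ext i
            simp only [Pi.add_apply, Pi.smul_apply, Pi.sub_apply, smul_eq_mul]
            ring
          rw [this, Pi.sub_apply, Pi.smul_apply, hzq i]
          conv_lhs => rw [hu]
          simp
        · rw [add_sub_cancel_left, hsmul]
          linarith
      have : κ * τ = 2 * κ * τ := by
        have h1 : intForm η 0 (q - u) = κ * τ := by rw [← hqκ, add_sub_cancel_left, hsmul]
        rw [← hp, add_sub_cancel_left, hsmul] at h1
        linarith
      linarith
    · have ha1' : a < 1 := lt_of_le_of_ne (by linarith) ha1
      have hU0 : U ≤ 0 := by rw [hU]; simpa using mul_nonneg hμ hl0.le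
      have hjle : j ≤ 0 := by
        by_contra hcon
        have : (1 : ℝ) ≤ j := by exact_mod_cast (by omega : 1 ≤ j)
        linarith
      have hjR : (j : ℝ) ≤ 0 := by exact_mod_cast hjle
      have h1 : μ' * l ≤ l := by nlinarith
      have hl1 : 1 + a ≤ l := by
        have : μ' * l = μ * l + g := by linarith
        have : μ * l = a - j := by rw [ha, hU]; ring
        linarith
      rw [hda] at hE
      have := mul_le_mul_of_nonneg_left hl1 (by linarith : 0 ≤ τ - 1)
      linarith
  -- This shear moves q to first coordinate 0 and fixes the line uw.
  set M : ℤ := j - m with hM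
  set cη : ℤ := η ⬝ᵥ P with hcη
  set cρ : ℤ := ρ ⬝ᵥ P with hcρ
  have hηc : ∀ x, intForm η cη x = intForm η 0 (x - PR) := by
    intro x
    have := intForm_intCast η 0 P
    rw [sub_zero] at this
    rw [hsub, this, ← hcη]
    simp [intForm]
  have hρc : ∀ x, intForm ρ cρ x = intForm ρ 0 (x - PR) := by
    intro x
    have := intForm_intCast ρ 0 P
    rw [sub_zero] at this
    rw [hsub, this, ← hcρ]
    simp [intForm]
  have hX : ∀ x, intForm (ρ + M • η) (cρ + j + M * cη) x =
      intForm ρ 0 (x - PR) - j + M * intForm η 0 (x - PR) := by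
    intro x
    rw [← hηc, ← hρc]
    simp only [intForm_fin_two, Pi.add_apply, Pi.smul_apply, smul_eq_mul]
    push_cast
    ring
  have hX₁u : intForm (ρ + M • η) (cρ + j + M * cη) u = -a := by
    rw [hX, ← neg_sub PR u, hPu, add_sub_cancel_left, ← neg_smul, hsmul, hsmul, hηD, hρD]
    rw [ha]; ring
  have hX₂u : intForm η cη u = 0 := by
    rw [hηc, ← neg_sub PR u, hPu, add_sub_cancel_left, ← neg_smul, hsmul, hηD, mul_zero]
  have hX₁q : intForm (ρ + M • η) (cρ + j + M * cη) q = 0 := by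
    rw [hX, hm, hh, hM]; push_cast; ring
  have hX₂q : intForm η cη q = 1 := by rw [hηc, hh]
  have hw : w = u + l • DR := by rw [← hwuD]; abel
  have hv' : v = u + τ • (q - u) := by
    rw [← hqκ, add_sub_cancel_left, smul_smul, mul_comm, hκτ, one_smul]; abel
  refine ⟨u, v, w, ρ + M • η, η, cρ + j + M * cη, cη, a, d, τ, rfl, hX₁u, hX₂u, ?_, ?_, ?_, ?_,
    ha0, by linarith, hτ1, hE, hF⟩
  · rw [hv', intForm_lineMap, hX₁u, hX₁q]; ring
  · rw [hv', intForm_lineMap, hX₂u, hX₂q]; ring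
  · have : w = u + l • ((u + DR) - u) := by rw [add_sub_cancel_left]; exact hw
    rw [this, intForm_lineMap, hX₁u]
    have : intForm (ρ + M • η) (cρ + j + M * cη) (u + DR) = -a + 1 := by
      rw [← hX₁u, hX, hX, show u + DR - PR = (u - PR) + DR by abel, hadd, hadd, hρD, hηD]
      ring
    rw [this, hd]; ring
  · have := hηuw w (right_mem_segment ℝ u w)
    rw [hηc, hsub]
    rw [hsub] at this hηP
    linarith

/-! ### Lower bounds on the relaxation from forms nonnegative on `L_α` -/

/-- The linear part `x ↦ πᵀ x` of an integral affine form. -/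
def intLinear {p : ℕ} (π : Fin p → ℤ) : (Fin p → ℝ) →ₗ[ℝ] ℝ where
  toFun x := (fun i => (π i : ℝ)) ⬝ᵥ x
  map_add' x y := dotProduct_add _ x y
  map_smul' t x := dotProduct_smul t _ x

lemma intForm_eq_intLinear {p : ℕ} (π : Fin p → ℤ) (c : ℤ) (x : Fin p → ℝ) :
    intForm π c x = intLinear π x - c := rfl

section InducedSet

variable {k : ℕ} {R : Matrix (Fin 2) (Fin k) ℚ} {f : Fin 2 → ℚ} {α : Fin k → ℝ}

lemma mem_inducedSet_of_generator {x : Fin 2 → ℝ}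
    (hx : x ∈ {x | ∃ i, 0 < α i ∧ x = realPoint f + (α i)⁻¹ • ray R i} ∪ {realPoint f}) :
    x ∈ inducedSet R f α :=
  Set.mem_add.2 ⟨x, subset_convexHull ℝ _ hx, 0, Submodule.zero_mem _, add_zero x⟩

lemma realPoint_mem_inducedSet : realPoint f ∈ inducedSet R f α :=
  mem_inducedSet_of_generator (Or.inr rfl)

/-- A linear form that is bounded below on `L_α` bounds the rays from below. -/
lemma neg_mul_le_ray_of_inducedSet (hα : ∀ i, 0 ≤ α i) (l : (Fin 2 → ℝ) →ₗ[ℝ] ℝ) (e : ℝ)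
    (h : ∀ x ∈ inducedSet R f α, 0 ≤ l x + e) (i : Fin k) :
    -(α i * (l (realPoint f) + e)) ≤ l (ray R i) := by
  rcases (hα i).eq_or_lt with h0 | h0
  · rw [← h0, zero_mul, neg_zero]
    by_contra hcon
    push Not at hcon
    have hf := h _ (realPoint_mem_inducedSet (R := R) (f := f) (α := α))
    -- For this s the form takes the value -1 at f + s rⁱ, a point of `L_α` because rⁱ is a
    -- recession direction.
    set s := (l (realPoint f) + e + 1) / (-l (ray R i)) with hs
    have hs0 : 0 ≤ s := div_nonneg (by linarith) (by linarith)
    have hmem : realPoint f + s • ray R i ∈ inducedSet R f α :=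
      Set.mem_add.2 ⟨_, subset_convexHull ℝ _ (Or.inr rfl), _,
        Submodule.smul_mem _ (⟨s, hs0⟩ : {c : ℝ // 0 ≤ c})
          (Submodule.subset_span ⟨i, h0.symm, rfl⟩), rfl⟩
    have := h _ hmem
    rw [map_add, map_smul, smul_eq_mul] at this
    have h2 : s * l (ray R i) = -(l (realPoint f) + e + 1) := by
      rw [hs, div_mul_eq_mul_div, div_neg, mul_div_cancel_right₀ _ hcon.ne]
    linarith
  · have := h _ (mem_inducedSet_of_generator (R := R) (f := f) (Or.inl ⟨i, h0, rfl⟩))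
    rw [map_add, map_smul, smul_eq_mul] at this
    have h2 := mul_le_mul_of_nonneg_left this h0.le
    have h3 : α i * ((α i)⁻¹ * l (ray R i)) = l (ray R i) := by
      rw [← mul_assoc, mul_inv_cancel₀ h0.ne', one_mul]
    linarith

lemma pointedCone_hull_nonneg {s : Set (Fin 2 → ℝ)} (l : (Fin 2 → ℝ) →ₗ[ℝ] ℝ)
    (h : ∀ x ∈ s, 0 ≤ l x) {y : Fin 2 → ℝ} (hy : y ∈ PointedCone.hull ℝ s) : 0 ≤ l y := by
  induction hy using Submodule.span_induction with
  | mem x hx => exact h x hx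
  | zero => simp
  | add x y _ _ hx hy => rw [map_add]; exact add_nonneg hx hy
  | smul a x _ hx =>
    change 0 ≤ l ((a : ℝ) • x)
    rw [map_smul]
    exact mul_nonneg a.2 hx

/-- If the form vanished at f, its linear part would be nonnegative on every ray, hence on the whole
plane, hence zero. -/
lemma pos_at_realPoint (hcone : PointedCone.hull ℝ (Set.range (ray R)) = ⊤) (hα : ∀ i, 0 ≤ α i)
    (l : (Fin 2 → ℝ) →ₗ[ℝ] ℝ) (e : ℝ) (h : ∀ x ∈ inducedSet R f α, 0 ≤ l x + e)
    (hl : ∃ x, l x ≠ 0) : 0 < l (realPoint f) + e := by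
  refine lt_of_le_of_ne (h _ realPoint_mem_inducedSet) fun h0 => ?_
  have hnn : ∀ y, 0 ≤ l y := by
    intro y
    refine pointedCone_hull_nonneg (s := Set.range (ray R)) l ?_ (by rw [hcone]; trivial)
    rintro _ ⟨i, rfl⟩
    have := neg_mul_le_ray_of_inducedSet hα l e h i
    rwa [← h0, mul_zero, neg_zero] at this
  obtain ⟨x, hx⟩ := hl
  have h1 := hnn x
  have h2 := hnn (-x)
  rw [map_neg] at h2
  exact hx (by linarith)

/-- An affine form that is nonnegative on `L_α` yields a lower bound for `∑ α_i s_i` on the linear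
relaxation. -/
lemma exists_lower_bound_linearRelaxation (hcone : PointedCone.hull ℝ (Set.range (ray R)) = ⊤)
    (hα : ∀ i, 0 ≤ α i) (l : (Fin 2 → ℝ) →ₗ[ℝ] ℝ) (e : ℝ)
    (h : ∀ x ∈ inducedSet R f α, 0 ≤ l x + e) (hl : ∃ x, l x ≠ 0) :
    ∃ ω : ℝ, 0 < ω ∧ ∀ z ∈ linearRelaxation R f, 1 - ω * (l z.1 + e) ≤ α ⬝ᵥ z.2 := by
  have hpos := pos_at_realPoint hcone hα l e h hl
  refine ⟨(l (realPoint f) + e)⁻¹, inv_pos.2 hpos, ?_⟩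
  rintro z ⟨hz, hs⟩
  have h1 : -((α ⬝ᵥ z.2) * (l (realPoint f) + e)) ≤ ∑ i, z.2 i * l (ray R i) := by
    rw [dotProduct, Finset.sum_mul, ← Finset.sum_neg_distrib]
    refine Finset.sum_le_sum fun i _ => ?_
    have := mul_le_mul_of_nonneg_left (neg_mul_le_ray_of_inducedSet hα l e h i) (hs i)
    linarith
  have h2 : l z.1 = l (realPoint f) + ∑ i, z.2 i * l (ray R i) := by
    rw [hz, map_add, map_sum]
    simp
  have h3 : (l (realPoint f) + e) * (1 - α ⬝ᵥ z.2) ≤ l z.1 + e := by linarith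
  have h4 : 1 - α ⬝ᵥ z.2 ≤ (l (realPoint f) + e)⁻¹ * (l z.1 + e) := by
    rw [inv_mul_eq_div, le_div_iff₀ hpos]; linarith
  linarith

/-- The points x and y serve only to certify that the form is not constant. -/
lemma exists_lower_bound_of_vertices (hcone : PointedCone.hull ℝ (Set.range (ray R)) = ⊤)
    (hα : ∀ i, 0 ≤ α i) {π₁ π₂ : Fin 2 → ℤ} {c₁ c₂ : ℤ} (e₀ e₁ e₂ : ℝ)
    (h : ∀ x ∈ inducedSet R f α, 0 ≤ e₀ + e₁ * intForm π₁ c₁ x + e₂ * intForm π₂ c₂ x)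
    (x y : Fin 2 → ℝ)
    (hxy : e₁ * intForm π₁ c₁ x + e₂ * intForm π₂ c₂ x ≠
      e₁ * intForm π₁ c₁ y + e₂ * intForm π₂ c₂ y) :
    ∃ ω : ℝ, 0 < ω ∧ ∀ z ∈ linearRelaxation R f,
      1 - ω * (e₀ + e₁ * intForm π₁ c₁ z.1 + e₂ * intForm π₂ c₂ z.1) ≤ α ⬝ᵥ z.2 := by
  have hform : ∀ x, e₀ + e₁ * intForm π₁ c₁ x + e₂ * intForm π₂ c₂ x =
      (e₁ • intLinear π₁ + e₂ • intLinear π₂) x + (e₀ - e₁ * c₁ - e₂ * c₂) := by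
    intro x
    simp only [intForm_eq_intLinear, LinearMap.add_apply, LinearMap.smul_apply, smul_eq_mul]
    ring
  obtain ⟨ω, hω, hω'⟩ := exists_lower_bound_linearRelaxation hcone hα
    (e₁ • intLinear π₁ + e₂ • intLinear π₂) (e₀ - e₁ * c₁ - e₂ * c₂)
    (fun x hx => by rw [← hform]; exact h x hx) (by
      by_contra hcon
      push Not at hcon
      have h1 := hform x
      have h2 := hform y
      rw [hcon] at h1 h2
      exact hxy (by linarith))
  refine ⟨ω, hω, fun z hz => ?_⟩
  rw [hform]
  exact hω' z hz

end InducedSet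

lemma nonneg_on_triangle {p : ℕ} {π₁ π₂ : Fin p → ℤ} {c₁ c₂ : ℤ} {e₀ e₁ e₂ : ℝ}
    {u v w : Fin p → ℝ}
    (hu : 0 ≤ e₀ + e₁ * intForm π₁ c₁ u + e₂ * intForm π₂ c₂ u)
    (hv : 0 ≤ e₀ + e₁ * intForm π₁ c₁ v + e₂ * intForm π₂ c₂ v)
    (hw : 0 ≤ e₀ + e₁ * intForm π₁ c₁ w + e₂ * intForm π₂ c₂ w) :
    ∀ x ∈ convexHull ℝ {u, v, w}, 0 ≤ e₀ + e₁ * intForm π₁ c₁ x + e₂ * intForm π₂ c₂ x := by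
  have hconv : Convex ℝ {x : Fin p → ℝ | 0 ≤ e₀ + e₁ * intForm π₁ c₁ x + e₂ * intForm π₂ c₂ x} := by
    intro x hx y hy a b ha hb hab
    simp only [Set.mem_ofPred_eq] at *
    rw [intForm_combo _ _ _ _ hab, intForm_combo _ _ _ _ hab]
    have h1 := mul_nonneg ha hx
    have h2 := mul_nonneg hb hy
    have h3 : e₀ = a * e₀ + b * e₀ := by rw [← add_mul, hab, one_mul]
    linarith
  refine convexHull_min ?_ hconv
  rintro x (rfl | rfl | rfl)
  exacts [hu, hv, hw]

/-! ### Rationality of the vertex u -/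

/-- An integral linear form takes rational values at rational points. -/
lemma exists_rat_intLinear (π : Fin 2 → ℤ) (x : Fin 2 → ℚ) :
    ∃ ρ : ℚ, intLinear π (fun j => (x j : ℝ)) = ρ :=
  ⟨∑ i, π i * x i, by simp [intLinear, dotProduct]⟩

/-- A vertex of `L_α` on a horizontal rational side below `f` that minimizes the first coordinate
has a rational first coordinate. -/
lemma exists_rat_of_inducedSet {k : ℕ} {R : Matrix (Fin 2) (Fin k) ℚ} {f : Fin 2 → ℚ}
    {α : Fin k → ℝ} (hcone : PointedCone.hull ℝ (Set.range (ray R)) = ⊤) (hα : ∀ i, 0 ≤ α i)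
    {π₁ π₂ : Fin 2 → ℤ} {c₁ c₂ : ℤ} {a : ℝ} {u : Fin 2 → ℝ} (ha : 0 < a)
    (hu : u ∈ inducedSet R f α) (hu₁ : intForm π₁ c₁ u = -a)
    (h₁ : ∀ x ∈ inducedSet R f α, 0 ≤ a + intForm π₁ c₁ x)
    (h₂ : ∀ x ∈ inducedSet R f α, 0 ≤ intForm π₂ c₂ x)
    (h₃ : ∀ x ∈ inducedSet R f α, 0 ≤ a + intForm π₁ c₁ x - a * intForm π₂ c₂ x)
    (hπ₂ : ∃ x, intLinear π₂ x ≠ 0) : ∃ ρ : ℚ, a = ρ := by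
  -- The minimum -a of x₁ must be attained at a generator, since the recession rays cannot decrease
  -- x₁.
  obtain ⟨s, hs, hsa⟩ : ∃ s ∈ {x | ∃ i, 0 < α i ∧ x = realPoint f + (α i)⁻¹ • ray R i} ∪
      {realPoint f}, intForm π₁ c₁ s ≤ -a := by
    by_contra! hcon
    obtain ⟨y, hy, c, hc, rfl⟩ := Set.mem_add.1 hu
    have hy' : -a < intForm π₁ c₁ y := by
      have hconv : Convex ℝ {x : Fin 2 → ℝ | -a + c₁ < intLinear π₁ x} :=
        convex_halfSpace_gt (intLinear π₁).isLinear _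
      have := convexHull_min (fun s hs => by
        have := hcon s hs
        rw [intForm_eq_intLinear] at this
        change -a + c₁ < intLinear π₁ s
        linarith) hconv hy
      rw [intForm_eq_intLinear]
      change -a + c₁ < intLinear π₁ y at this
      linarith
    have hc' : 0 ≤ intLinear π₁ c := by
      refine pointedCone_hull_nonneg _ ?_ hc
      rintro _ ⟨i, hi, rfl⟩
      have := neg_mul_le_ray_of_inducedSet (R := R) (f := f) hα (intLinear π₁) (a - c₁)
        (fun x hx => by have := h₁ x hx; rw [intForm_eq_intLinear] at this; linarith) i
      rwa [hi, zero_mul, neg_zero] at this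
    rw [intForm_eq_intLinear, map_add] at hu₁
    rw [intForm_eq_intLinear] at hy'
    linarith
  have hsL := mem_inducedSet_of_generator hs
  have e2 := h₂ s hsL
  have e3 := h₃ s hsL
  have hs₂ : intForm π₂ c₂ s = 0 := by
    have : a * intForm π₂ c₂ s ≤ a * 0 := by linarith
    exact le_antisymm (le_of_mul_le_mul_left this ha) e2
  have hs₁ : intForm π₁ c₁ s = -a := by rw [hs₂] at e3; linarith
  have hf₂ := pos_at_realPoint (R := R) (f := f) hcone hα (intLinear π₂) (-c₂)
    (fun x hx => by have := h₂ x hx; rw [intForm_eq_intLinear] at this; linarith) hπ₂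
  obtain ⟨F₁, hF₁⟩ := exists_rat_intLinear π₁ f
  obtain ⟨F₂, hF₂⟩ := exists_rat_intLinear π₂ f
  change intLinear π₁ (realPoint f) = F₁ at hF₁
  change intLinear π₂ (realPoint f) = F₂ at hF₂
  rw [intForm_eq_intLinear] at hs₁ hs₂
  rcases hs with ⟨i, hi, rfl⟩ | rfl
  · obtain ⟨r₁, hr₁⟩ := exists_rat_intLinear π₁ (fun j => R j i)
    obtain ⟨r₂, hr₂⟩ := exists_rat_intLinear π₂ (fun j => R j i)
    change intLinear π₁ (ray R i) = r₁ at hr₁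
    change intLinear π₂ (ray R i) = r₂ at hr₂
    rw [map_add, map_smul, smul_eq_mul, hF₁, hr₁] at hs₁
    rw [map_add, map_smul, smul_eq_mul, hF₂, hr₂] at hs₂
    rw [hF₂] at hf₂
    have hr0 : (r₂ : ℝ) ≠ 0 := by
      intro h
      rw [h] at hs₂
      linarith
    -- The rational ray from the rational point f meets the line x₂ = 0 transversally, which forces
    -- 1/αᵢ to be rational.
    refine ⟨c₁ - F₁ - (c₂ - F₂) / r₂ * r₁, ?_⟩
    have : (α i)⁻¹ = (c₂ - F₂) / r₂ := by
      rw [eq_div_iff hr0]; linarith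
    rw [this] at hs₁
    push_cast
    linarith
  · rw [hF₁] at hs₁
    exact ⟨c₁ - F₁, by push_cast; linarith⟩

end

/-! ### Assembling the bounds -/

/-- The inequality `∑ α_i s_i ≥ 1` is written as `0ᵀ x + (-α)ᵀ s ≤ -1`. -/
theorem mainTheorem2 (k : ℕ) (R : Matrix (Fin 2) (Fin k) ℚ) (f : Fin 2 → ℚ) (α : Fin k → ℝ)
    (hf : realPoint f ∉ latticePoints)
    (hR : ∀ i, ray R i ≠ 0)
    (hcone : PointedCone.hull ℝ (Set.range (ray R)) = ⊤)
    (hα : ∀ i, 0 ≤ α i)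
    (hvalid : IsValidIneq 0 (-α) (-1) (convexHull ℝ (mixedIntegerSet R f)))
    (hL : IsTypeT2B (inducedSet R f α)) :
    splitRank (linearRelaxation R f) 0 (-α) (-1) < ⊤ := by
  obtain ⟨u, v, w, π₁, π₂, c₁, c₂, a, d, τ, hLeq, hu₁, hu₂, hv₁, hv₂, hw₁, hw₂, ha, had, hτ, hE,
    hF⟩ := hL.exists_coordinates
  have nn : ∀ e₀ e₁ e₂ : ℝ, 0 ≤ e₀ + e₁ * -a → 0 ≤ e₀ + e₁ * ((τ - 1) * a) + e₂ * τ →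
      0 ≤ e₀ + e₁ * d → ∀ x ∈ inducedSet R f α,
        0 ≤ e₀ + e₁ * intForm π₁ c₁ x + e₂ * intForm π₂ c₂ x := by
    intro e₀ e₁ e₂ h1 h2 h3
    rw [hLeq]
    refine nonneg_on_triangle ?_ ?_ ?_
    · rw [hu₁, hu₂]; linarith
    · rw [hv₁, hv₂]; linarith
    · rw [hw₁, hw₂]; linarith
  have hτa : 0 < (τ - 1) * a := mul_pos (by linarith) ha
  -- `n₂`, `n₃`, `n₄` vanish on the sides uw, uv, vw, and `n₅` on the line through v and (1, 1);
  -- `n₁` is needed only for rationality. By `hE`, (1, 1) lies strictly beyond vw, so σ > 0; by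
  -- `hF`, B > 0.
  have n₁ := nn a 1 0 (by linarith) (by linarith) (by linarith)
  have n₂ := nn 0 0 1 (by linarith) (by linarith) (by linarith)
  have n₃ := nn a 1 (-a) (by linarith) (by linarith) (by linarith)
  have n₄ := nn (τ * d) (-τ) ((τ - 1) * a - d) (by nlinarith) (by linarith) (by linarith)
  have n₅ := nn (τ - (τ - 1) * a) (-(τ - 1)) (-(1 - (τ - 1) * a)) (by linarith) (by linarith)
    (by linarith)
  obtain ⟨ρ, hρ⟩ := exists_rat_of_inducedSet (π₂ := π₂) (c₂ := c₂) hcone hα ha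
    (by rw [hLeq]; exact subset_convexHull _ _ (by simp)) hu₁
    (fun x hx => by linarith [n₁ x hx]) (fun x hx => by linarith [n₂ x hx])
    (fun x hx => by linarith [n₃ x hx]) (by
      by_contra! hcon
      rw [intForm_eq_intLinear, hcon] at hu₂ hv₂
      linarith)
  obtain ⟨ω₂, hω₂, b₂⟩ := exists_lower_bound_of_vertices hcone hα _ _ _ n₂ u v (by
    rw [hu₂, hv₂]; intro h; linarith)
  obtain ⟨ω₃, hω₃, b₃⟩ := exists_lower_bound_of_vertices hcone hα _ _ _ n₃ u w (by
    rw [hu₁, hw₁, hu₂, hw₂]; intro h; linarith)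
  obtain ⟨ω₄, hω₄, b₄⟩ := exists_lower_bound_of_vertices hcone hα _ _ _ n₄ u w (by
    rw [hu₁, hw₁, hu₂, hw₂]; intro h; nlinarith)
  obtain ⟨ω₅, hω₅, b₅⟩ := exists_lower_bound_of_vertices hcone hα _ _ _ n₅ u w (by
    rw [hu₁, hw₁, hu₂, hw₂]; intro h; nlinarith)
  have hden : (0 : ℝ) < ρ.den := by exact_mod_cast ρ.pos
  have hnum : (ρ.den : ℝ) * a = ρ.num := by
    rw [hρ]
    exact_mod_cast Rat.den_mul_eq_num ρ
  obtain ⟨N, hN⟩ := exists_iterSplitClosure_one_le (Q := linearRelaxation R f) (α := α)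
    (π₁ := π₁) (π₂ := π₂) (π₃ := (ρ.den : ℤ) • π₁ - ρ.num • π₂) (c₁ := c₁) (c₂ := c₂)
    (c₃ := ρ.den * c₁ - ρ.num - ρ.num * c₂) (ω := ω₂) (c := ω₃) (a := a) (n := ρ.den)
    (A := ω₅ * (τ - 1)) (B := ω₅ * (1 - (τ - 1) * a)) (σ := ω₄ * (τ - (τ - 1) * (d + a)))
    (s := ω₄ * τ) (r := ω₄ * (d - (τ - 1) * a)) ha hden hω₂
    (mul_nonneg hω₅.le (by linarith)) (mul_nonneg hω₄.le (by linarith)) hω₃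
    (mul_pos hω₅ (by linarith)) (mul_pos hω₄ (by linarith))
    (fun x => by
      simp only [intForm_fin_two, Pi.sub_apply, Pi.smul_apply, smul_eq_mul]
      push_cast
      rw [← hnum]
      ring)
    (fun z hz => Finset.sum_nonneg fun i _ => mul_nonneg (hα i) (hz.2 i))
    (fun z hz => by linarith [b₂ z hz]) (fun z hz => by linarith [b₃ z hz])
    (fun z hz => by linarith [b₅ z hz]) (fun z hz => by linarith [b₄ z hz])
  refine lt_of_le_of_lt (iInf₂_le N fun z hz => ?_) (ENat.natCast_lt_top N)
  have := hN z hz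
  simp only [zero_dotProduct, neg_dotProduct, zero_add]
  linarith
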